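/- For elements $a,b$ of the field $\mathbb{Q}((q))$ of formal Laurent series for which the series converges formally, let $$f(a,b)=\sum_{n\in\mathbb{Z}}a^{n(n+1)/2}\,b^{n(n-1)/2}$$ be Ramanujan's theta series. For a positive integer $M$ and a Laurent series $G(q)=\sum_n g_nq^n$, let $$\mathbf{H}_M\big(G(q)\big)=\sum_n g_{Mn}q^{Mn}$$ be the huffing operator; thus $\mathbf{H}_M\big(q^{-w}G(q)\big)=0$ if and only if $g_{Mn+w}=0$ for all $n\in\mathbb{Z}$. Theorem. Let $\mu\ge 1$, $\ell\ge 0$ and $m\ge 0$ be integers. All identities below are between formal Laurent series in $q$, and the quotients are taken in $\mathbb{Q}((q))$. (i) If $M=2\ell+6m+3$ and $\sigma=-(2\ell+4m+2)k$, then for all $\kappa\in\{0,1\}$, $\lambda\in\{0,1\}$ and every integer $k$ with $\gcd(k,M)=1$, $$\mathbf{H}_{M}\Bigg(q^{\sigma}\cdot f\big((-1)^{\kappa}q^{k},(-1)^{\kappa}q^{\mu M-k}\big)^{2\ell} \bigg(\frac{f\big({-q^{2k}},-q^{\mu M-2k}\big)}{f\big((-1)^{\lambda}q^{k},(-1)^{\lambda}q^{\mu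 M-k}\big)}\bigg)^{2m+1}\Bigg)=0.$$ (ii) If $M=8\ell+6m+3$ and $\sigma=-(6\ell+4m+2)k$, then for all $\kappa\in\{0,1\}$, $\lambda\in\{0,1\}$ and every integer $k$ with $\gcd(k,M)=1$, $$\mathbf{H}_{M}\Bigg(q^{\sigma}\cdot f\big((-1)^{\kappa}q^{2k},(-1)^{\kappa}q^{\mu M-2k}\big)^{2\ell} \bigg(\frac{f\big({-q^{2k}},-q^{\mu M-2k}\big)}{f\big((-1)^{\lambda}q^{k},(-1)^{\lambda}q^{\mu M-k}\big)}\bigg)^{2m+1}\Bigg)=0.$$ (iii) If $M=4\ell+6m+5$ and $\sigma=-(2\ell+2m+2)k$, then for $\kappa=1$, all $\lambda\in\{0,1\}$ and every integer $k$ with $\gcd(k,M)=1$, $$\mathbf{H}_{M}\Bigg(q^{\sigma}\cdot f\big((-1)^{\kappa}q^{2k},(-1)^{\kappa}q^{\mu M-2k}\big)^{2\ell+1} \bigg(\frac{f\big({-q^{2k}},-q^{\mu M-2k}\big)}{f\big((-1)^{\lambda}q^{k},(-1)^{\lambda}q^{\mu M-k}\big)}\bigg)^{4m+2}\Bigg)=0.$$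 -/

import Mathlib

noncomputable section

/-- The indeterminate `q` of the field of formal Laurent series over `ℚ`. -/
def qVar : LaurentSeries ℚ := HahnSeries.single (1 : ℤ) (1 : ℚ)

/-- The `n`-th term `a ^ (n(n+1)/2) * b ^ (n(n-1)/2)` of Ramanujan's theta series. Both integer
divisions are exact. -/
def thetaTerm (a b : LaurentSeries ℚ) (n : ℤ) : LaurentSeries ℚ :=
  a ^ (n * (n + 1) / 2) * b ^ (n * (n - 1) / 2)

/-- The two-sided series `∑ n : ℤ, a ^ (n(n+1)/2) * b ^ (n(n-1)/2)` converges formally: the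
exponents of `q` occurring in its terms are bounded below, and each power of `q` occurs in only
finitely many terms. -/
def ThetaSummable (a b : LaurentSeries ℚ) : Prop :=
  (⋃ n : ℤ, (thetaTerm a b n).support).IsPWO ∧
    ∀ N : ℤ, {n : ℤ | (thetaTerm a b n).coeff N ≠ 0}.Finite

open Classical in
/-- Ramanujan's theta series `f(a, b) = ∑ n : ℤ, a ^ (n(n+1)/2) * b ^ (n(n-1)/2)`, as a formal
Laurent series (with value `0` if the series does not converge formally). -/
def ramanujanTheta (a b : LaurentSeries ℚ) : LaurentSeries ℚ :=
  if h : ThetaSummable a b then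
    HahnSeries.SummableFamily.hsum
      ({ toFun := thetaTerm a b
         isPWO_iUnion_support' := h.1
         finite_co_support' := h.2 } : HahnSeries.SummableFamily ℤ ℚ ℤ)
  else 0

/-- The huffing operator: `∑ g_n q^n` is sent to `∑ g_{Mn} q^{Mn}`. -/
def huff (M : ℕ) (G : LaurentSeries ℚ) : LaurentSeries ℚ where
  coeff n := if (M : ℤ) ∣ n then G.coeff n else 0
  isPWO_support' := G.isPWO_support.mono (by
    intro n hn
    simp only [Function.mem_support, ne_eq, ite_eq_right_iff, Classical.not_imp] at hn
    exact hn.2)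

theorem qVar_zpow (n : ℤ) : qVar ^ n = HahnSeries.single n (1 : ℚ) := by
  rw [qVar]; exact (RatFunc.single_zpow (F := ℚ) n).symm

theorem thetaTerm_eq (e : ℕ) (u v n : ℤ) :
    thetaTerm ((-1) ^ e * qVar ^ u) ((-1) ^ e * qVar ^ v) n =
      HahnSeries.single (u * (n * (n + 1) / 2) + v * (n * (n - 1) / 2))
        (((-1) ^ e) ^ n : ℚ) := by
  have hq : qVar ≠ 0 := by simp [qVar]
  have hm : ((-1 : LaurentSeries ℚ) ^ e) ≠ 0 := by simp
  have h2 : n * (n + 1) / 2 + n * (n - 1) / 2 = n * n := by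
    have h1 : (2 : ℤ) ∣ n * (n + 1) := (Int.even_mul_succ_self n).two_dvd
    have h3 : (2 : ℤ) ∣ n * (n - 1) := (Int.even_mul_pred_self n).two_dvd
    obtain ⟨x, hx⟩ := h1
    obtain ⟨y, hy⟩ := h3
    rw [hx, hy]
    simp only [ne_eq, OfNat.ofNat_ne_zero, not_false_eq_true, Int.mul_ediv_cancel_left]
    nlinarith
  rw [thetaTerm, mul_zpow, mul_zpow, ← zpow_mul, ← zpow_mul, mul_mul_mul_comm, ← zpow_add₀ hm,
    ← zpow_add₀ hq, h2, qVar_zpow]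
  rcases Nat.even_or_odd e with he | he
  · simp [he.neg_one_pow]
  · rw [he.neg_one_pow, he.neg_one_pow]
    rcases Int.even_or_odd n with hn | hn
    · rw [(hn.mul_left n).neg_one_zpow, hn.neg_one_zpow, one_mul]
    · rw [(hn.mul hn).neg_one_zpow, hn.neg_one_zpow]
      simp

/-- The theta series `f(± q^u, ± q^v)` converges formally as soon as `u + v > 0`. -/
theorem thetaSummable_of_pos (e : ℕ) (u v : ℤ) (h : 0 < u + v) :
    ThetaSummable ((-1) ^ e * qVar ^ u) ((-1) ^ e * qVar ^ v) := by
  have key : ∀ n : ℤ, 2 * (u * (n * (n + 1) / 2) + v * (n * (n - 1) / 2)) =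
      (u + v) * n ^ 2 + (u - v) * n := by
    intro n
    have h1 : 2 * (n * (n + 1) / 2) = n * (n + 1) :=
      Int.mul_ediv_cancel' (Int.even_mul_succ_self n).two_dvd
    have h3 : 2 * (n * (n - 1) / 2) = n * (n - 1) :=
      Int.mul_ediv_cancel' (Int.even_mul_pred_self n).two_dvd
    linear_combination u * h1 + v * h3
  have bd : ∀ n : ℤ, n ^ 2 - (u - v) ^ 2 ≤
      4 * (u * (n * (n + 1) / 2) + v * (n * (n - 1) / 2)) := by
    intro n
    have := key n
    nlinarith [sq_nonneg (n + (u - v)), sq_nonneg n]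
  constructor
  · apply Set.IsWF.isPWO
    apply BddBelow.isWF
    refine ⟨-(u - v) ^ 2, ?_⟩
    intro N hN
    obtain ⟨n, hn⟩ := Set.mem_iUnion.mp hN
    rw [thetaTerm_eq] at hn
    have := HahnSeries.support_single_subset hn
    rw [Set.mem_singleton_iff] at this
    have hb := bd n
    rw [← this] at hb
    nlinarith [sq_nonneg n, sq_nonneg (u - v)]
  · intro N
    apply (Set.finite_Icc (-(4 * |N| + (u - v) ^ 2)) (4 * |N| + (u - v) ^ 2)).subset
    intro n hn
    rw [Set.mem_ofPred_eq, thetaTerm_eq] at hn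
    have hN : N = u * (n * (n + 1) / 2) + v * (n * (n - 1) / 2) := by
      by_contra hne
      exact hn (HahnSeries.coeff_single_of_ne hne)
    have hb := bd n
    rw [← hN] at hb
    have h4 := le_abs_self N
    rw [Set.mem_Icc]
    constructor
    · nlinarith [Int.le_self_sq (-n)]
    · nlinarith [Int.le_self_sq n]

/-- The theta series `f(± q^u, ± q^v)` is nonzero if `u + v > 0` and `u + v` does not divide `2u`;
so one may divide by it. -/
theorem ramanujanTheta_ne_zero (e : ℕ) (u v : ℤ) (h : 0 < u + v) (hd : ¬ u + v ∣ 2 * u) :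
    ramanujanTheta ((-1) ^ e * qVar ^ u) ((-1) ^ e * qVar ^ v) ≠ 0 := by
  have hs := thetaSummable_of_pos e u v h
  intro h0
  have hc : (ramanujanTheta ((-1) ^ e * qVar ^ u) ((-1) ^ e * qVar ^ v)).coeff 0 = 1 := by
    rw [ramanujanTheta, dif_pos hs, HahnSeries.SummableFamily.coeff_hsum,
      finsum_eq_single _ (0 : ℤ)]
    · simp [thetaTerm]
    · intro n hn
      rw [HahnSeries.SummableFamily.coe_mk, thetaTerm_eq]
      apply HahnSeries.coeff_single_of_ne
      intro hN
      have h1 : 2 * (n * (n + 1) / 2) = n * (n + 1) :=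
        Int.mul_ediv_cancel' (Int.even_mul_succ_self n).two_dvd
      have h3 : 2 * (n * (n - 1) / 2) = n * (n - 1) :=
        Int.mul_ediv_cancel' (Int.even_mul_pred_self n).two_dvd
      have h5 : n * ((u + v) * n + (u - v)) = 0 := by
        linear_combination (-2) * hN - u * h1 - v * h3
      rcases mul_eq_zero.mp h5 with h6 | h6
      · exact hn h6
      · exact hd ⟨1 - n, by linear_combination h6⟩
  rw [h0] at hc
  simp at hc

end

/-! Put `p = μM` and `z = q ^ k`. The quintuple product identity reads `C * f(-z², -q^p/z²) = f(εz,
εq^p/z) * Q(εz)`, where `C ≠ 0` is a series in `q ^ p` and `Q` an explicit signed sum of monomials.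
Since `M ∣ p`, huffing commutes with multiplication by `C`, so each quotient in the theorem may be
replaced by `Q(εz)`. No division remains, and `C` need not be evaluated.

What is left is a product of theta-like series, a signed sum of monomials `q ^ (pP) z ^ T`. Each
factor is quasi-invariant under `z ↦ 1/z` and `z ↦ q^p z`; on indices this gives reflections `ρ t`
with `T ↦ S + N t - T`, where the degree `N` and the shift `S` add over factors
(`IsReflective.mul`). As `gcd(k, M) = 1`, huffing after multiplication by `q ^ (-wk)` retains
exactly the terms with `T ≡ w` mod `M`. In all three cases `N` is `M` or `2M`, and `w` is such that
`2T - S` is then a multiple `N t`. So `ρ t` preserves `P` and `T`, it reverses the sign, and the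
terms cancel in pairs (`IsReflective.coeff_eq_zero`). -/

noncomputable section

open HahnSeries

/-! ### Formal sums of signed monomials -/

/-- An exponent function is proper if only finitely many indices have bounded exponent. -/
def IsProper {ι : Type*} (e : ι → ℤ) : Prop := ∀ N : ℤ, {i | e i ≤ N}.Finite

namespace IsProper

variable {ι κ : Type*} {e : ι → ℤ} {e' : κ → ℤ}

theorem bddBelow (h : IsProper e) : ∃ B, ∀ i, B ≤ e i := by
  obtain ⟨B, hB⟩ := ((h 0).image e).bddBelow
  refine ⟨min B 0, fun i => ?_⟩
  rcases le_total (e i) 0 with hi | hi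
  · exact (min_le_left _ _).trans (hB ⟨i, hi, rfl⟩)
  · exact (min_le_right _ _).trans hi

theorem finite_eq (h : IsProper e) (N : ℤ) : {i | e i = N}.Finite :=
  (h N).subset fun _ hi => le_of_eq hi

theorem add (h : IsProper e) (h' : IsProper e') : IsProper fun x : ι × κ => e x.1 + e' x.2 := by
  intro N
  obtain ⟨B, hB⟩ := h.bddBelow
  obtain ⟨B', hB'⟩ := h'.bddBelow
  refine ((h (N - B')).prod (h' (N - B))).subset fun x hx => ?_
  have h1 := hB x.1
  have h2 := hB' x.2
  simp only [Set.mem_ofPred_eq, Set.mem_prod] at hx ⊢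
  omega

theorem comp_injective (h : IsProper e) {g : κ → ι} (hg : Function.Injective g) :
    IsProper fun x => e (g x) := by
  intro N
  have := (h N).preimage (f := g) hg.injOn
  exact this

theorem of_bool {e : ι × Bool → ℤ} (h : ∀ b, IsProper fun i => e (i, b)) : IsProper e := by
  intro N
  refine (((h false N).image fun i => (i, false)).union
    ((h true N).image fun i => (i, true))).subset ?_
  rintro ⟨i, b⟩ hi
  cases b
  · exact Or.inl ⟨i, hi, rfl⟩
  · exact Or.inr ⟨i, hi, rfl⟩

theorem of_quadratic {a b c : ℤ} {e : ℤ → ℤ} (ha : 0 < a)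
    (he : ∀ n, 2 * e n = a * n ^ 2 + b * n + c) : IsProper e := by
  intro N
  refine (Set.finite_Icc (-(|b| + 2 * |N| + |c|)) (|b| + 2 * |N| + |c|)).subset fun n hn => ?_
  have hn' : e n ≤ N := hn
  have h1 := he n
  rw [Set.mem_Icc, ← abs_le]
  by_contra! hlt
  have h2 : -(|b| * |n|) ≤ b * n := by
    rw [← abs_mul]
    exact neg_abs_le _
  have h3 : |n| ^ 2 ≤ a * n ^ 2 := by
    rw [sq_abs]
    nlinarith [sq_nonneg n]
  have h4 := le_abs_self N
  have h5 := abs_nonneg N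
  have h6 := abs_nonneg b
  have h7 := neg_abs_le c
  have h8 := abs_nonneg c
  nlinarith

end IsProper

/-- The summable family of signed monomials `c i * q ^ e i`. -/
def monomialFamily {ι : Type*} (e : ι → ℤ) (c : ι → ℤˣ) (h : IsProper e) :
    SummableFamily ℤ ℚ ι where
  toFun i := single (e i) (((c i : ℤˣ) : ℤ) : ℚ)
  isPWO_iUnion_support' := by
    obtain ⟨B, hB⟩ := h.bddBelow
    apply Set.IsWF.isPWO
    apply BddBelow.isWF
    refine ⟨B, fun N hN => ?_⟩
    obtain ⟨i, hi⟩ := Set.mem_iUnion.mp hN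
    rw [Set.mem_singleton_iff.mp (support_single_subset hi)]
    exact hB i
  finite_co_support' N := by
    refine (h.finite_eq N).subset fun i hi => ?_
    by_contra hne
    exact hi (coeff_single_of_ne fun h' => hne h'.symm)

theorem coeff_hsum_monomialFamily {ι : Type*} {e : ι → ℤ} {c : ι → ℤˣ} (h : IsProper e) (N : ℤ) :
    (monomialFamily e c h).hsum.coeff N =
      ∑ i ∈ (h.finite_eq N).toFinset, (((c i : ℤˣ) : ℤ) : ℚ) := by
  rw [SummableFamily.coeff_hsum_eq_sum_of_subset (t := (h.finite_eq N).toFinset)]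
  · refine Finset.sum_congr rfl fun i hi => ?_
    have hi' : e i = N := by simpa using hi
    change (single (e i) _).coeff N = _
    rw [hi', coeff_single_same]
  · intro i hi
    by_contra hne
    exact hi (coeff_single_of_ne fun h' => hne (by simpa using h'.symm))

theorem hsum_monomialFamily_mul {ι κ : Type*} {e : ι → ℤ} {e' : κ → ℤ} {c : ι → ℤˣ}
    {c' : κ → ℤˣ} (h : IsProper e) (h' : IsProper e') :
    (monomialFamily e c h).hsum * (monomialFamily e' c' h').hsum =
      (monomialFamily (fun x : ι × κ => e x.1 + e' x.2) (fun x => c x.1 * c' x.2)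
        (h.add h')).hsum := by
  rw [← SummableFamily.hsum_mul]
  congr 1
  ext x : 1
  simp [monomialFamily, single_mul_single]

theorem hsum_monomialFamily_congr {ι : Type*} {e e' : ι → ℤ} {c c' : ι → ℤˣ} (h : IsProper e)
    (he : ∀ i, e i = e' i) (hc : ∀ i, c i = c' i) :
    ∃ h' : IsProper e', (monomialFamily e c h).hsum = (monomialFamily e' c' h').hsum := by
  obtain rfl : e = e' := funext he
  obtain rfl : c = c' := funext hc
  exact ⟨h, rfl⟩

/-! ### Reflections and cancellation -/

/-- `G` is a signed sum of monomials `q ^ (p * P i + k * T i)` whose index set carries reflections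
`ρ t`, acting on the data as `z ↦ 1 / z` followed by a power of `z ↦ q ^ p * z` acts on a theta
function of degree `N` in `z = q ^ k`. -/
def IsReflective (p k N S : ℤ) (δ η : ℤˣ) (G : LaurentSeries ℚ) : Prop :=
  ∃ (ι : Type) (P T : ι → ℤ) (c : ι → ℤˣ) (ρ : ℤ → ι → ι)
    (h : IsProper fun i => p * P i + k * T i),
    G = (monomialFamily _ c h).hsum ∧ (∀ t i, ρ t (ρ t i) = i) ∧
    (∀ t i, T (ρ t i) = S + N * t - T i) ∧
    (∀ t i, 2 * P (ρ t i) = 2 * P i + t * (N * t + S) - 2 * t * T i) ∧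
    ∀ t i, c (ρ t i) = δ * η ^ t * c i

namespace IsReflective

variable {p k N S N' S' : ℤ} {δ η δ' η' : ℤˣ} {G G' : LaurentSeries ℚ}

theorem one : IsReflective p k 0 0 1 1 1 := by
  have h : IsProper fun _ : Unit => p * 0 + k * 0 := fun _ => Set.toFinite _
  refine ⟨Unit, fun _ => 0, fun _ => 0, fun _ => 1, fun _ i => i, h, ?_, ?_⟩
  · rw [SummableFamily.hsum_unique]
    change 1 = single (p * 0 + k * 0) _
    simp
  · simp

/-- The same `t` reflects both factors at once. The changes of `P` and `T` are linear in `(P, T, N,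
S)`, so they add up. -/
theorem mul (hG : IsReflective p k N S δ η G) (hG' : IsReflective p k N' S' δ' η' G') :
    IsReflective p k (N + N') (S + S') (δ * δ') (η * η') (G * G') := by
  obtain ⟨ι, P, T, c, ρ, h, rfl, h1, h2, h3, h4⟩ := hG
  obtain ⟨ι', P', T', c', ρ', h', rfl, h1', h2', h3', h4'⟩ := hG'
  rw [hsum_monomialFamily_mul]
  obtain ⟨h'', heq⟩ := hsum_monomialFamily_congr (c := fun x : ι × ι' => c x.1 * c' x.2)
    (e' := fun x : ι × ι' => p * (P x.1 + P' x.2) + k * (T x.1 + T' x.2)) (h.add h')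
    (fun x => by ring) (fun _ => rfl)
  rw [heq]
  refine ⟨ι × ι', _, _, _, fun t x => (ρ t x.1, ρ' t x.2), h'', rfl, fun t x => ?_, fun t x => ?_,
    fun t x => ?_, fun t x => ?_⟩
  · simp [h1, h1']
  · linear_combination h2 t x.1 + h2' t x.2
  · linear_combination h3 t x.1 + h3' t x.2
  · simp only [h4, h4', mul_zpow]
    ac_rfl

theorem pow (hG : IsReflective p k N S δ η G) (n : ℕ) :
    IsReflective p k (n * N) (n * S) (δ ^ n) (η ^ n) (G ^ n) := by
  induction n with
  | zero => simpa using one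
  | succ n ih =>
    have := ih.mul hG
    rw [← pow_succ, ← pow_succ, ← pow_succ] at this
    rwa [← add_one_mul, ← add_one_mul, ← Nat.cast_succ] at this

/-- A coefficient vanishes if all its indices are paired off with sign `-1` by reflections. -/
theorem coeff_eq_zero (hG : IsReflective p k N S δ η G) (hN : N ≠ 0) (n : ℤ)
    (h : ∀ P T : ℤ, p * P + k * T = n → ∃ t, 2 * T - S = N * t ∧ δ * η ^ t = -1) :
    G.coeff n = 0 := by
  obtain ⟨ι, P, T, c, ρ, hp, rfl, h1, h2, h3, h4⟩ := hG
  rw [coeff_hsum_monomialFamily]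
  have key : ∀ i, p * P i + k * T i = n → ∃ t, (2 * T i - S) / N = t ∧ T (ρ t i) = T i ∧
      P (ρ t i) = P i ∧ c (ρ t i) = -c i := by
    intro i hi
    obtain ⟨t, ht, hs⟩ := h _ _ hi
    refine ⟨t, by rw [ht, Int.mul_ediv_cancel_left _ hN], ?_, ?_, ?_⟩
    · linear_combination h2 t i - ht
    · have := h3 t i
      have h5 : t * (N * t + S) - 2 * t * T i = 0 := by linear_combination -t * ht
      omega
    · rw [h4, hs, neg_one_mul]
  -- The choice of `t` depends only on `T`, which the reflection preserves; hence the map is an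
  -- involution. It has no fixed point because it negates a sign.
  refine Finset.sum_involution (fun i _ => ρ ((2 * T i - S) / N) i) ?_ ?_ ?_ ?_
  · intro i hi
    obtain ⟨t, rfl, -, -, hc⟩ := key i (by simpa using hi)
    simp [hc]
  · intro i hi _ hfix
    obtain ⟨t, rfl, -, -, hc⟩ := key i (by simpa using hi)
    rw [hfix] at hc
    exact units_ne_neg_self _ hc
  · intro i hi
    obtain ⟨t, rfl, hT, hP, -⟩ := key i (by simpa using hi)
    simpa [hT, hP] using hi
  · intro i hi
    obtain ⟨t, rfl, hT, -, -⟩ := key i (by simpa using hi)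
    simp only [hT, h1]

end IsReflective

/-! ### Theta series as reflective series -/

/-- The triangular exponent `n(n-1)/2`. -/
def tri (n : ℤ) : ℤ := n * (n - 1) / 2

theorem two_mul_tri (n : ℤ) : 2 * tri n = n * (n - 1) :=
  Int.mul_ediv_cancel' (Int.even_mul_pred_self n).two_dvd

theorem tri_nonneg (n : ℤ) : 0 ≤ tri n := by
  have := two_mul_tri n
  have : 0 ≤ n * (n - 1) := by
    rcases le_or_gt n 0 with h | h <;> nlinarith
  omega

theorem isProper_theta {p : ℤ} (hp : 0 < p) (u : ℤ) : IsProper fun n => p * tri n + u * n :=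
  .of_quadratic (a := p) (b := 2 * u - p) (c := 0) hp fun n => by
    linear_combination p * two_mul_tri n

theorem ramanujanTheta_eq_hsum {p : ℤ} (hp : 0 < p) (u : ℤ) (e : ℕ) :
    ramanujanTheta ((-1) ^ e * qVar ^ u) ((-1) ^ e * qVar ^ (p - u)) =
      (monomialFamily _ (fun n => ((-1) ^ e) ^ n) (isProper_theta hp u)).hsum := by
  rw [ramanujanTheta, dif_pos (thetaSummable_of_pos e u (p - u) (by omega))]
  congr 1
  ext n : 1
  change thetaTerm _ _ n = single (p * tri n + u * n) _
  rw [thetaTerm_eq]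
  congr 1
  · have h1 : 2 * (n * (n + 1) / 2) = n * (n + 1) :=
      Int.mul_ediv_cancel' (Int.even_mul_succ_self n).two_dvd
    have h2 := two_mul_tri n
    have h3 : n * (n + 1) / 2 = tri n + n := by linarith
    congr 1
    change u * (n * (n + 1) / 2) + (p - u) * tri n = p * tri n + u * n
    rw [h3]
    ring
  · rcases Nat.even_or_odd e with he | he
    · simp [he.neg_one_pow]
    · rcases Int.even_or_odd n with hn | hn <;>
        simp [he.neg_one_pow, hn.neg_one_zpow]

theorem Int.units_zpow_sub_eq (ε : ℤˣ) (m n : ℤ) : ε ^ (m - n) = ε ^ m * ε ^ n := by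
  rw [zpow_sub, ← inv_zpow, Int.units_inv_eq_self]

/-- With respect to its own variable `z ^ a`, the theta series has reflections `n ↦ 1 + s - n`.
Taking `s = a t` makes the change of `T = a n` match a shift of `z` by `q ^ (p t)`, whence degree `a
^ 2`. -/
theorem isReflective_theta {p : ℤ} (hp : 0 < p) (k a : ℤ) (e : ℕ) :
    IsReflective p k (a ^ 2) a ((-1) ^ e) (((-1) ^ e) ^ a)
      (ramanujanTheta ((-1) ^ e * qVar ^ (a * k)) ((-1) ^ e * qVar ^ (p - a * k))) := by
  rw [ramanujanTheta_eq_hsum hp]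
  obtain ⟨h, heq⟩ := hsum_monomialFamily_congr (c := fun n => (((-1) ^ e) ^ n : ℤˣ))
    (e' := fun n => p * tri n + k * (a * n)) (isProper_theta hp (a * k))
    (fun n => by ring) (fun _ => rfl)
  refine ⟨ℤ, tri, fun n => a * n, _, fun t n => 1 + a * t - n, h, heq, fun t n => sub_sub_cancel _ _,
    fun t n => by ring, fun t n => ?_, fun t n => ?_⟩
  · linear_combination two_mul_tri (1 + a * t - n) - two_mul_tri n
  · rw [Int.units_zpow_sub_eq, zpow_add, zpow_mul, zpow_one]

theorem Bool.toInt_not (b : Bool) : (!b).toInt = 1 - b.toInt := by cases b <;> rfl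

/-! ### The quintuple product identity -/

/-- The exponent of `z` in the quintuple product series
`∑ q ^ (p * n(3n-1)/2) z ^ (3n) (1 - z q ^ (pn))`, whose terms are indexed by `ℤ × Bool`. -/
def quintupleDeg (x : ℤ × Bool) : ℤ := 3 * x.1 + x.2.toInt

/-- The exponent of `q ^ p` in the quintuple product series. -/
def quintupleExp (x : ℤ × Bool) : ℤ := x.1 ^ 2 + tri x.1 + x.1 * x.2.toInt

/-- The signs in the quintuple product series at `ε z`. -/
def quintupleSign (ε : ℤˣ) (x : ℤ × Bool) : ℤˣ := ε ^ quintupleDeg x * (-1) ^ x.2.toInt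

theorem isProper_quintuple {p : ℤ} (hp : 0 < p) (k : ℤ) :
    IsProper fun x => p * quintupleExp x + k * quintupleDeg x := by
  refine .of_bool fun b => .of_quadratic (a := 3 * p) (b := 6 * k - p + 2 * p * b.toInt)
    (c := 2 * k * b.toInt) (by omega) fun n => ?_
  simp only [quintupleExp, quintupleDeg]
  linear_combination p * two_mul_tri n

/-- The quintuple product series at `ε q ^ k`. -/
def quintupleSeries {p : ℤ} (hp : 0 < p) (k : ℤ) (ε : ℤˣ) : LaurentSeries ℚ :=
  (monomialFamily _ (quintupleSign ε) (isProper_quintuple hp k)).hsum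

theorem isReflective_quintupleSeries {p : ℤ} (hp : 0 < p) (k : ℤ) (ε : ℤˣ) :
    IsReflective p k 3 1 (-ε) ε (quintupleSeries hp k ε) := by
  refine ⟨ℤ × Bool, quintupleExp, quintupleDeg, quintupleSign ε, fun t x => (t - x.1, !x.2),
    isProper_quintuple hp k, rfl, fun t x => ?_, fun t x => ?_, fun t x => ?_, fun t x => ?_⟩
  · simp
  · simp only [quintupleDeg, Bool.toInt_not]
    ring
  · simp only [quintupleDeg, quintupleExp, Bool.toInt_not]
    linear_combination two_mul_tri (t - x.1) - two_mul_tri x.1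
  · have h : quintupleDeg (t - x.1, !x.2) = 1 + 3 * t - quintupleDeg x := by
      simp only [quintupleDeg, Bool.toInt_not]
      ring
    -- The degree changes by `3 t`, which contributes `ε ^ (3 t) = ε ^ t`.
    have h3 : ε ^ (3 : ℤ) = ε := by
      rw [show (3 : ℤ) = 1 - (-2) by norm_num, Int.units_zpow_sub_eq]
      simp
    simp only [quintupleSign, h, Bool.toInt_not, Int.units_zpow_sub_eq, zpow_add, zpow_mul, h3,
      zpow_one]
    simp only [neg_mul, one_mul, mul_neg, mul_assoc]

/-- Sends a pair of a term of `f(-z², -q ^ p / z²)` and a term of degree `0` of the product of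
`f(εz, ε q ^ p / z)` with the quintuple product series to a term of even degree of that product. -/
def toEvenDeg (y : (ℤ × Bool) × ℤ) : ℤ × (ℤ × Bool) :=
  -- The product has `N = 4` and `S = 2`. From degree `0`, the shift by `r` reaches degree `4 r`,
  -- and the reflection by `r` reaches `4 r + 2`; with `r = y.2 / 2` both equal `2 * y.2`.
  if y.2 % 2 = 0 then (y.2 / 2 - quintupleDeg y.1, (y.1.1 + y.2 / 2, y.1.2))
  else (1 + y.2 / 2 + quintupleDeg y.1, (y.2 / 2 - y.1.1, !y.1.2))

/-- The inverse of `toEvenDeg`. -/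
def ofEvenDeg (w : ℤ × (ℤ × Bool)) : (ℤ × Bool) × ℤ :=
  let n := (w.1 + quintupleDeg w.2) / 2
  (if n % 2 = 0 then (w.2.1 - n / 2, w.2.2) else (n / 2 - w.2.1, !w.2.2), n)

theorem toEvenDeg_deg (y : (ℤ × Bool) × ℤ) :
    (toEvenDeg y).1 + quintupleDeg (toEvenDeg y).2 = 2 * y.2 := by
  unfold toEvenDeg
  split_ifs with h
  · simp only [quintupleDeg]
    omega
  · simp only [quintupleDeg, Bool.toInt_not]
    omega

theorem ofEvenDeg_toEvenDeg (y : (ℤ × Bool) × ℤ) : ofEvenDeg (toEvenDeg y) = y := by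
  have h1 : (2 * y.2) / 2 = y.2 := by omega
  simp only [ofEvenDeg, toEvenDeg_deg, h1]
  unfold toEvenDeg
  split_ifs with h <;> simp

theorem toEvenDeg_ofEvenDeg (w : ℤ × (ℤ × Bool)) (h : Even (w.1 + quintupleDeg w.2)) :
    toEvenDeg (ofEvenDeg w) = w := by
  obtain ⟨n, hn⟩ := h
  obtain ⟨i, a, b⟩ := w
  have h1 : (i + quintupleDeg (a, b)) / 2 = n := by
    simp only at hn
    omega
  simp only [ofEvenDeg, h1, toEvenDeg]
  simp only [quintupleDeg] at hn h1
  split_ifs with h2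
  · ext <;> simp [quintupleDeg]
    omega
  · ext <;> simp [quintupleDeg, Bool.toInt_not]
    omega

theorem toEvenDeg_exp (y : (ℤ × Bool) × ℤ) :
    tri (toEvenDeg y).1 + quintupleExp (toEvenDeg y).2 =
      tri (-quintupleDeg y.1) + quintupleExp y.1 + tri y.2 := by
  obtain ⟨⟨a, b⟩, n⟩ := y
  have hb : b.toInt * b.toInt = b.toInt := by cases b <;> rfl
  have h0 : ∀ u v : ℤ, 2 * u = 2 * v → u = v := fun u v h => by omega
  apply h0
  unfold toEvenDeg
  split_ifs with h
  · obtain ⟨r, rfl⟩ : ∃ r, n = 2 * r := ⟨n / 2, by simp only at h; omega⟩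
    have hr : 2 * r / 2 = r := by omega
    simp only [quintupleDeg, quintupleExp, hr]
    linear_combination two_mul_tri (r - (3 * a + b.toInt)) + two_mul_tri (a + r)
      - two_mul_tri (-(3 * a + b.toInt)) - two_mul_tri a - two_mul_tri (2 * r)
  · obtain ⟨r, rfl⟩ : ∃ r, n = 2 * r + 1 := ⟨n / 2, by simp only at h; omega⟩
    have hr : (2 * r + 1) / 2 = r := by omega
    simp only [quintupleDeg, quintupleExp, hr, Bool.toInt_not]
    linear_combination two_mul_tri (1 + r + (3 * a + b.toInt)) + two_mul_tri (r - a)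
      - two_mul_tri (-(3 * a + b.toInt)) - two_mul_tri a - two_mul_tri (2 * r + 1)

theorem toEvenDeg_sign (y : (ℤ × Bool) × ℤ) :
    ((-1) ^ (toEvenDeg y).2.2.toInt : ℤˣ) = (-1) ^ y.1.2.toInt * (-1) ^ y.2 := by
  unfold toEvenDeg
  split_ifs with h
  · rw [(Int.even_iff.mpr h).neg_one_zpow, mul_one]
  · rw [(Int.odd_iff (n := y.2).mpr (by omega)).neg_one_zpow, Bool.toInt_not, Int.units_zpow_sub_eq]
    simp

/-- The reflection of the terms of odd degree of the product of `f(εz, ε q ^ p / z)` with the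
quintuple product series that preserves the degree. -/
def reflectOddDeg (w : ℤ × (ℤ × Bool)) : ℤ × (ℤ × Bool) :=
  -- The reflection by `t` sends degree `D` to `2 + 4 t - D`, which fixes `D = 2 t + 1`.
  let t := (w.1 + quintupleDeg w.2) / 2
  (1 + t - w.1, (t - w.2.1, !w.2.2))

theorem reflectOddDeg_deg {w : ℤ × (ℤ × Bool)} (h : ¬ Even (w.1 + quintupleDeg w.2)) :
    (reflectOddDeg w).1 + quintupleDeg (reflectOddDeg w).2 = w.1 + quintupleDeg w.2 := by
  rw [Int.not_even_iff_odd, Int.odd_iff] at h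
  simp only [reflectOddDeg, quintupleDeg, Bool.toInt_not] at h ⊢
  omega

theorem reflectOddDeg_reflectOddDeg {w : ℤ × (ℤ × Bool)}
    (h : ¬ Even (w.1 + quintupleDeg w.2)) : reflectOddDeg (reflectOddDeg w) = w := by
  rw [reflectOddDeg, reflectOddDeg_deg h]
  simp [reflectOddDeg]

theorem reflectOddDeg_exp {w : ℤ × (ℤ × Bool)} (h : ¬ Even (w.1 + quintupleDeg w.2)) :
    tri (reflectOddDeg w).1 + quintupleExp (reflectOddDeg w).2 =
      tri w.1 + quintupleExp w.2 := by
  rw [Int.not_even_iff_odd] at h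
  obtain ⟨t, ht⟩ := h
  have h1 : (w.1 + quintupleDeg w.2) / 2 = t := by omega
  have h0 : ∀ u v : ℤ, 2 * u = 2 * v → u = v := fun u v h => by omega
  apply h0
  simp only [reflectOddDeg, h1, quintupleExp, Bool.toInt_not]
  simp only [quintupleDeg] at ht
  linear_combination two_mul_tri (1 + t - w.1) + two_mul_tri (t - w.2.1) - two_mul_tri w.1
    - two_mul_tri w.2.1 - 2 * t * ht

theorem theta_mul_quintuple_sign (ε : ℤˣ) (i : ℤ) (x : ℤ × Bool) :
    ε ^ i * quintupleSign ε x = ε ^ (i + quintupleDeg x) * (-1) ^ x.2.toInt := by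
  rw [quintupleSign, zpow_add, mul_assoc]

/-- The terms of degree `0` in the product are the pairs `(-quintupleDeg x, x)`, so properness
restricts from the product. -/
theorem isProper_quintupleConst {p : ℤ} (hp : 0 < p) :
    IsProper fun x => p * (tri (-quintupleDeg x) + quintupleExp x) := by
  have h := ((isProper_theta hp 0).add (isProper_quintuple hp 0)).comp_injective
    (g := fun x => (-quintupleDeg x, x)) fun x y h => (Prod.ext_iff.mp h).2
  convert h using 2 with x
  ring

/-- The part of degree `0` in `z` of the product of `f(εz, ε q ^ p / z)` with the quintuple product
series at `εz`. -/
def quintupleConst {p : ℤ} (hp : 0 < p) : LaurentSeries ℚ :=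
  (monomialFamily _ (fun x => (-1) ^ x.2.toInt) (isProper_quintupleConst hp)).hsum

theorem quintupleConst_ne_zero {p : ℤ} (hp : 0 < p) : quintupleConst hp ≠ 0 := by
  intro h0
  have h1 : (quintupleConst hp).coeff 0 = 1 := by
    rw [quintupleConst, coeff_hsum_monomialFamily, Finset.sum_eq_single (0, false)]
    · simp
    · rintro ⟨a, b⟩ hx hne
      exfalso
      have hx : tri (-quintupleDeg (a, b)) + quintupleExp (a, b) = 0 := by
        simpa [hp.ne'] using hx
      have h1 := tri_nonneg (-quintupleDeg (a, b))
      have h2 := tri_nonneg a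
      have h3 := two_mul_tri a
      apply hne
      cases b
      · have : a = 0 := by
          simp only [quintupleExp, Bool.toInt, cond_false] at hx
          nlinarith
        rw [this]
      · simp only [quintupleExp, quintupleDeg, Bool.toInt, cond_true] at hx h1
        have h4 := two_mul_tri (-(3 * a + 1))
        rcases le_or_gt a (-1) with h5 | h5 <;> nlinarith
    · intro h
      simp [quintupleDeg, quintupleExp, tri, Bool.toInt] at h
  rw [h0] at h1
  simp at h1

theorem dvd_of_coeff_quintupleConst_ne_zero {p : ℤ} (hp : 0 < p) {n : ℤ}
    (h : (quintupleConst hp).coeff n ≠ 0) : p ∣ n := by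
  rw [quintupleConst, coeff_hsum_monomialFamily] at h
  obtain ⟨x, hx, -⟩ := Finset.exists_ne_zero_of_sum_ne_zero h
  exact ⟨_, ((Set.Finite.mem_toFinset _).mp hx).symm⟩

/-- The quintuple product identity, up to the determination of the factor independent of `z`. -/
theorem quintupleConst_mul_theta {p : ℤ} (hp : 0 < p) (k : ℤ) (e : ℕ) :
    quintupleConst hp * ramanujanTheta (-qVar ^ (2 * k)) (-qVar ^ (p - 2 * k)) =
      ramanujanTheta ((-1) ^ e * qVar ^ k) ((-1) ^ e * qVar ^ (p - k)) *
        quintupleSeries hp k ((-1) ^ e) := by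
  have hA := ramanujanTheta_eq_hsum hp (2 * k) 1
  rw [pow_one, pow_one, neg_one_mul, neg_one_mul] at hA
  rw [hA, ramanujanTheta_eq_hsum hp, quintupleConst, quintupleSeries, hsum_monomialFamily_mul,
    hsum_monomialFamily_mul]
  generalize ((-1) ^ e : ℤˣ) = ε
  ext N
  rw [coeff_hsum_monomialFamily, coeff_hsum_monomialFamily]
  -- Terms of odd degree cancel: the reflection keeps the degree, hence the power of `ε`, and flips
  -- the Boolean sign. Terms of even degree are then matched bijectively.
  have hodd : ∑ w ∈ (((isProper_theta hp k).add (isProper_quintuple hp k)).finite_eq N).toFinset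
      with ¬ Even (w.1 + quintupleDeg w.2),
      (((ε ^ w.1 * quintupleSign ε w.2 : ℤˣ) : ℤ) : ℚ) = 0 := by
    refine Finset.sum_involution (fun w _ => reflectOddDeg w) ?_ ?_ ?_ ?_
    · intro w hw
      have hw := (Finset.mem_filter.mp hw).2
      rw [theta_mul_quintuple_sign, theta_mul_quintuple_sign, reflectOddDeg_deg hw]
      simp [reflectOddDeg, Bool.toInt_not, Int.units_zpow_sub_eq]
    · intro w _ _ hfix
      have := congrArg (fun w => w.2.2) hfix
      simp [reflectOddDeg] at this
    · intro w hw
      simp only [Finset.mem_filter, Set.Finite.mem_toFinset, Set.mem_ofPred_eq] at hw ⊢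
      rw [reflectOddDeg_deg hw.2]
      refine ⟨?_, hw.2⟩
      linear_combination hw.1 + p * reflectOddDeg_exp hw.2 + k * reflectOddDeg_deg hw.2
    · intro w hw
      exact reflectOddDeg_reflectOddDeg (Finset.mem_filter.mp hw).2
  rw [← Finset.sum_filter_add_sum_filter_not
    (((isProper_theta hp k).add (isProper_quintuple hp k)).finite_eq N).toFinset
    (fun w : ℤ × (ℤ × Bool) => Even (w.1 + quintupleDeg w.2)), hodd, add_zero]
  have hexp : ∀ y, p * tri (toEvenDeg y).1 + k * (toEvenDeg y).1 +
      (p * quintupleExp (toEvenDeg y).2 + k * quintupleDeg (toEvenDeg y).2) =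
      p * (tri (-quintupleDeg y.1) + quintupleExp y.1) + (p * tri y.2 + 2 * k * y.2) := fun y => by
    linear_combination p * toEvenDeg_exp y + k * toEvenDeg_deg y
  refine Finset.sum_nbij' toEvenDeg ofEvenDeg ?_ ?_ ?_ ?_ ?_
  · intro y hy
    simp only [Finset.mem_filter, Set.Finite.mem_toFinset, Set.mem_ofPred_eq] at hy ⊢
    rw [toEvenDeg_deg, hexp]
    exact ⟨hy, even_two_mul _⟩
  · intro w hw
    simp only [Finset.mem_filter, Set.Finite.mem_toFinset, Set.mem_ofPred_eq] at hw ⊢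
    rw [← hexp, toEvenDeg_ofEvenDeg w hw.2]
    exact hw.1
  · exact fun y _ => ofEvenDeg_toEvenDeg y
  · exact fun w hw => toEvenDeg_ofEvenDeg w (Finset.mem_filter.mp hw).2
  · intro y _
    rw [theta_mul_quintuple_sign, toEvenDeg_sign, toEvenDeg_deg, zpow_mul, zpow_ofNat,
      Int.units_sq, one_zpow, one_mul]

/-! ### Huffing and the reduction to reflections -/

theorem coeff_huff (M : ℕ) (G : LaurentSeries ℚ) (n : ℤ) :
    (huff M G).coeff n = if (M : ℤ) ∣ n then G.coeff n else 0 := rfl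

theorem huff_mul (M : ℕ) {C : LaurentSeries ℚ} (hC : ∀ n, C.coeff n ≠ 0 → (M : ℤ) ∣ n)
    (G : LaurentSeries ℚ) : huff M (C * G) = C * huff M G := by
  have hs : (huff M G).support ⊆ G.support := fun n hn h0 => hn (by simp [coeff_huff, h0])
  ext n
  rw [coeff_huff, coeff_mul_right' G.isPWO_support hs]
  split_ifs with h
  · rw [coeff_mul]
    refine Finset.sum_congr rfl fun ij hij => ?_
    rw [Finset.mem_antidiagonal] at hij
    have h1 := hC _ hij.1
    rw [coeff_huff, if_pos ((Int.dvd_add_right h1).mp (hij.2.2 ▸ h))]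
  · refine (Finset.sum_eq_zero fun ij hij => ?_).symm
    rw [Finset.mem_antidiagonal] at hij
    have h1 := hC _ hij.1
    rw [coeff_huff, if_neg fun h2 => h (hij.2.2 ▸ dvd_add h1 h2), mul_zero]

theorem huff_pow_mul (M : ℕ) {C : LaurentSeries ℚ} (hC : ∀ n, C.coeff n ≠ 0 → (M : ℤ) ∣ n)
    (G : LaurentSeries ℚ) (n : ℕ) : huff M (C ^ n * G) = C ^ n * huff M G := by
  induction n with
  | zero => simp
  | succ n ih => rw [pow_succ', mul_assoc, huff_mul M hC, ih, mul_assoc]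

/-- Multiplying a reflective series by a power of a theta quotient does not affect whether its
huffing vanishes because of the reflections. -/
theorem huff_mul_theta_div_pow_eq_zero {M : ℕ} {p k N S σ w : ℤ} {δ η : ℤˣ} {e r : ℕ}
    {F : LaurentSeries ℚ} (hp : 0 < p) (hMp : (M : ℤ) ∣ p) (hkM : Int.gcd k M = 1)
    (hpk : ¬ p ∣ 2 * k) (hF : IsReflective p k N S δ η F) (hσ : σ = -w * k) (hN : N + r * 3 ≠ 0)
    (h : ∀ T : ℤ, (M : ℤ) ∣ T - w → ∃ t, 2 * T - (S + r * 1) = (N + r * 3) * t ∧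
      δ * (-(-1) ^ e) ^ r * (η * ((-1) ^ e) ^ r) ^ t = -1) :
    huff M (qVar ^ σ * F *
      (ramanujanTheta (-qVar ^ (2 * k)) (-qVar ^ (p - 2 * k)) /
        ramanujanTheta ((-1) ^ e * qVar ^ k) ((-1) ^ e * qVar ^ (p - k))) ^ r) = 0 := by
  have hB := ramanujanTheta_ne_zero e k (p - k) (by omega) (by rwa [add_sub_cancel])
  have hC := quintupleConst_ne_zero hp
  have hCp : ∀ n, (quintupleConst hp).coeff n ≠ 0 → (M : ℤ) ∣ n := fun n hn =>
    hMp.trans (dvd_of_coeff_quintupleConst_ne_zero hp hn)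
  have hq : quintupleConst hp * (ramanujanTheta (-qVar ^ (2 * k)) (-qVar ^ (p - 2 * k)) /
      ramanujanTheta ((-1) ^ e * qVar ^ k) ((-1) ^ e * qVar ^ (p - k))) =
      quintupleSeries hp k ((-1) ^ e) := by
    rw [← mul_div_assoc, quintupleConst_mul_theta hp k e, mul_div_cancel_left₀ _ hB]
  -- Multiplying by `C ^ r` turns the quotient into the quintuple series, and can be undone since `C
  -- ≠ 0`.
  refine (mul_eq_zero_iff_left (pow_ne_zero r hC)).mp ?_
  rw [← huff_pow_mul M hCp, mul_left_comm, ← mul_pow, hq, mul_assoc]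
  have hR := hF.mul ((isReflective_quintupleSeries hp k ((-1) ^ e)).pow r)
  ext n
  rw [coeff_huff, coeff_zero]
  split_ifs with hn
  · rw [qVar_zpow, coeff_single_mul, one_mul]
    refine hR.coeff_eq_zero hN _ fun P T hPT => h T ?_
    -- A retained exponent is `n = p P + k (T - w)`, with `M` dividing `n` and `p`.
    have h1 : (M : ℤ) ∣ k * (T - w) := by
      have h2 : k * (T - w) = n - p * P := by rw [hσ] at hPT; linear_combination hPT
      rw [h2]
      exact dvd_sub hn (hMp.mul_right P)
    exact IsCoprime.dvd_of_dvd_mul_left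
      (Int.isCoprime_iff_gcd_eq_one.mpr (by rwa [Int.gcd_comm])) h1
  · rfl

theorem Int.units_pow_two_mul (u : ℤˣ) (n : ℕ) : u ^ (2 * n) = 1 := by
  rw [pow_mul, Int.units_sq, one_pow]

theorem Int.units_pow_two_mul_add_one (u : ℤˣ) (n : ℕ) : u ^ (2 * n + 1) = u := by
  rw [pow_succ, Int.units_pow_two_mul, one_mul]

theorem Int.units_zpow_two_mul_add_one (u : ℤˣ) (n : ℤ) : u ^ (2 * n + 1) = u := by
  rw [zpow_add, zpow_mul, zpow_ofNat, Int.units_sq, one_zpow, one_mul, zpow_one]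

/-- Ensures that the theta series in the denominator is nonzero. -/
theorem not_mul_dvd_two_mul {μ M : ℕ} {k : ℤ} (hM : Odd M) (h1 : 1 < M) (hk : Int.gcd k M = 1) :
    ¬ ((μ * M : ℤ) ∣ 2 * k) := by
  intro h
  have h2 : (M : ℤ) ∣ 2 * k := (Dvd.intro_left _ rfl).trans h
  have h3 : (M : ℤ) ∣ 2 := IsCoprime.dvd_of_dvd_mul_right
    (Int.isCoprime_iff_gcd_eq_one.mpr (by rwa [Int.gcd_comm])) h2
  have h4 : M ∣ 2 := by exact_mod_cast h3
  have h5 := Nat.le_of_dvd two_pos h4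
  obtain ⟨r, hr⟩ := hM
  omega

end

/-! ### The three families -/

theorem mainTheorem1 (μ ℓ m : ℕ) (hμ : 1 ≤ μ) :
    (∀ (M κ lam : ℕ) (k σ : ℤ), M = 2 * ℓ + 6 * m + 3 → σ = -(2 * ℓ + 4 * m + 2) * k →
      κ ∈ ({0, 1} : Set ℕ) → lam ∈ ({0, 1} : Set ℕ) → Int.gcd k M = 1 →
      huff M (qVar ^ σ *
        ramanujanTheta ((-1) ^ κ * qVar ^ k) ((-1) ^ κ * qVar ^ (μ * M - k)) ^ (2 * ℓ) *
        (ramanujanTheta (-qVar ^ (2 * k)) (-qVar ^ (μ * M - 2 * k)) /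
          ramanujanTheta ((-1) ^ lam * qVar ^ k) ((-1) ^ lam * qVar ^ (μ * M - k))) ^ (2 * m + 1)) =
        0) ∧
    (∀ (M κ lam : ℕ) (k σ : ℤ), M = 8 * ℓ + 6 * m + 3 → σ = -(6 * ℓ + 4 * m + 2) * k →
      κ ∈ ({0, 1} : Set ℕ) → lam ∈ ({0, 1} : Set ℕ) → Int.gcd k M = 1 →
      huff M (qVar ^ σ *
        ramanujanTheta ((-1) ^ κ * qVar ^ (2 * k)) ((-1) ^ κ * qVar ^ (μ * M - 2 * k)) ^ (2 * ℓ) *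
        (ramanujanTheta (-qVar ^ (2 * k)) (-qVar ^ (μ * M - 2 * k)) /
          ramanujanTheta ((-1) ^ lam * qVar ^ k) ((-1) ^ lam * qVar ^ (μ * M - k))) ^ (2 * m + 1)) =
        0) ∧
    (∀ (M κ lam : ℕ) (k σ : ℤ), M = 4 * ℓ + 6 * m + 5 → σ = -(2 * ℓ + 2 * m + 2) * k →
      κ ∈ ({1} : Set ℕ) → lam ∈ ({0, 1} : Set ℕ) → Int.gcd k M = 1 →
      huff M (qVar ^ σ *
        ramanujanTheta ((-1) ^ κ * qVar ^ (2 * k)) ((-1) ^ κ * qVar ^ (μ * M - 2 * k)) ^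
          (2 * ℓ + 1) *
        (ramanujanTheta (-qVar ^ (2 * k)) (-qVar ^ (μ * M - 2 * k)) /
          ramanujanTheta ((-1) ^ lam * qVar ^ k) ((-1) ^ lam * qVar ^ (μ * M - k))) ^ (4 * m + 2)) =
        0) := by
  refine ⟨fun M κ lam k σ hM hσ _ _ hk => ?_, fun M κ lam k σ hM hσ _ _ hk => ?_,
    fun M κ lam k σ hM hσ hκ _ hk => ?_⟩
  · have hp : (0 : ℤ) < μ * M := by rw [hM]; positivity
    have hMc : (M : ℤ) = 2 * ℓ + 6 * m + 3 := by exact_mod_cast hM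
    have hF := (isReflective_theta hp k 1 κ).pow (2 * ℓ)
    rw [one_mul] at hF
    refine huff_mul_theta_div_pow_eq_zero (w := 2 * ℓ + 4 * m + 2) hp (Dvd.intro_left _ rfl) hk
      (not_mul_dvd_two_mul ⟨ℓ + 3 * m + 1, by omega⟩ (by omega) hk) hF hσ
      (by push_cast; positivity) ?_
    rintro T ⟨s, hs⟩
    -- Here `N = M` and `2 w - S = M`, so `t` is odd and the sign is `-ε * ε = -1`, with `ε = (-1) ^
    -- lam`; the even theta power contributes no sign.
    refine ⟨2 * s + 1, ?_, ?_⟩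
    · push_cast
      linear_combination 2 * hs + 2 * s * hMc
    · simp [Int.units_zpow_two_mul_add_one, Int.units_pow_two_mul_add_one, Int.units_pow_two_mul]
  · have hp : (0 : ℤ) < μ * M := by rw [hM]; positivity
    have hMc : (M : ℤ) = 8 * ℓ + 6 * m + 3 := by exact_mod_cast hM
    refine huff_mul_theta_div_pow_eq_zero (w := 6 * ℓ + 4 * m + 2) hp (Dvd.intro_left _ rfl) hk
      (not_mul_dvd_two_mul ⟨4 * ℓ + 3 * m + 1, by omega⟩ (by omega) hk)
      ((isReflective_theta hp k 2 κ).pow (2 * ℓ)) hσ (by push_cast; positivity) ?_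
    rintro T ⟨s, hs⟩
    refine ⟨2 * s + 1, ?_, ?_⟩
    · push_cast
      linear_combination 2 * hs + 2 * s * hMc
    · simp [Int.units_zpow_two_mul_add_one, Int.units_pow_two_mul_add_one, Int.units_pow_two_mul]
  · have hp : (0 : ℤ) < μ * M := by rw [hM]; positivity
    have hMc : (M : ℤ) = 4 * ℓ + 6 * m + 5 := by exact_mod_cast hM
    obtain rfl : κ = 1 := hκ
    refine huff_mul_theta_div_pow_eq_zero (w := 2 * ℓ + 2 * m + 2) hp (Dvd.intro_left _ rfl) hk
      (not_mul_dvd_two_mul ⟨2 * ℓ + 3 * m + 2, by omega⟩ (by omega) hk)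
      ((isReflective_theta hp k 2 1).pow (2 * ℓ + 1)) hσ (by push_cast; positivity) ?_
    rintro T ⟨s, hs⟩
    -- Here `N = 2 M` and `S = 2 w`. The quintuple factors appear to an even power, so the sign `-1`
    -- comes from the odd theta power with `κ = 1`.
    refine ⟨s, ?_, ?_⟩
    · push_cast
      linear_combination 2 * hs + 2 * s * hMc
    · rw [show 4 * m + 2 = 2 * (2 * m + 1) by ring]
      simp [Int.units_pow_two_mul_add_one, Int.units_pow_two_mul]
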